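/- Fix an odd prime $\ell$, and let $\mathcal{G}$ be the poset of isomorphism classes of finite abelian $\ell$-groups, where $A\le B$ if and only if there is an injective group homomorphism $A\hookrightarrow B$. For $A\in\mathcal{G}$ put $\operatorname{rank} A=\dim_{\mathbb{F}_\ell}(A/\ell A)$. For $A,C\in\mathcal{G}$ let $\operatorname{sub}(A,C)$ be the number of subgroups of $C$ that are isomorphic to $A$. An $A$-chain is a finite linearly ordered subset $\mathfrak{C}=\{A_1<\cdots<A_i\}$ of $\{B\in\mathcal{G}\mid B>A\}$, and for a nonempty $A$-chain $$\operatorname{sub}(\mathfrak{C})=(-1)^i\operatorname{sub}(A,A_1)\prod_{j=1}^{i-1}\operatorname{sub}(A_j,A_{j+1}).$$ Define $S:\mathcal{G}\times\mathcal{G}\to\mathbb{Z}$ by $S(A,C)=0$ if $A\not\le C$, $S(A,C)=1$ if $A=C$, and $$S(A,C)=\sum_{\substack{A\text{-chains }\mathfrak{C}\\ \max\mathfrak{C}=C}}\operatorname{sub}(\mathfrak{C})\qquad\text{if } A<C.$$ **Theorem.** Let $A,C\in\mathcal{G}$ with $\operatorname{rank}A<\operatorname{rank}C$. If $k>0$ is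 an integer and $B\in\mathcal{G}$ is such that $A\le B<C$, $\operatorname{rank}B=\operatorname{rank}A$ and $B\oplus(\mathbb{Z}/\ell)^{k}\cong C$, then $S(A,C)=S(A,B)\cdot S(B,C)$. If no such $k$ and $B$ exist, then $S(A,C)=0$. -/

import Mathlib

universe u

/-- A finite abelian `ℓ`-group (written additively). -/
structure FinAbPGroup (ℓ : ℕ) where
  carrier : Type u
  [addCommGroup : AddCommGroup carrier]
  [finite : Finite carrier]
  isPGroup : IsPGroup ℓ (Multiplicative carrier)

namespace FinAbPGroup

attribute [instance] FinAbPGroup.addCommGroup FinAbPGroup.finite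

instance (ℓ : ℕ) : CoeSort (FinAbPGroup.{u} ℓ) (Type u) := ⟨FinAbPGroup.carrier⟩

/-- Isomorphism of finite abelian `ℓ`-groups. -/
instance isoSetoid (ℓ : ℕ) : Setoid (FinAbPGroup.{u} ℓ) where
  r A B := Nonempty (A ≃+ B)
  iseqv :=
    ⟨fun A => ⟨AddEquiv.refl A⟩, fun ⟨e⟩ => ⟨e.symm⟩, fun ⟨e⟩ ⟨f⟩ => ⟨e.trans f⟩⟩

/-- The subgroup `ℓA` of `A`. -/
def mulSubgroup {ℓ : ℕ} (A : FinAbPGroup.{u} ℓ) : AddSubgroup A :=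
  (nsmulAddMonoidHom (α := A) ℓ).range

theorem nsmul_mem_mulSubgroup {ℓ : ℕ} (A : FinAbPGroup.{u} ℓ) (x : A) :
    ℓ • x ∈ A.mulSubgroup := ⟨x, rfl⟩

/-- The `𝔽_ℓ`-vector space structure on `A / ℓA`. -/
instance {ℓ : ℕ} (A : FinAbPGroup.{u} ℓ) : Module (ZMod ℓ) (A ⧸ A.mulSubgroup) :=
  QuotientAddGroup.zmodModule A.nsmul_mem_mulSubgroup

/-- The rank of `A`: the dimension of `A / ℓA` over `𝔽_ℓ`. -/
noncomputable def rank {ℓ : ℕ} (A : FinAbPGroup.{u} ℓ) : ℕ :=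
  Module.finrank (ZMod ℓ) (A ⧸ A.mulSubgroup)

theorem rank_congr {ℓ : ℕ} (A B : FinAbPGroup.{u} ℓ) (h : A ≈ B) : A.rank = B.rank := by
  obtain ⟨e⟩ := h
  have he : A.mulSubgroup.map (e : A →+ B) = B.mulSubgroup := by
    ext y
    constructor
    · rintro ⟨_, ⟨x, rfl⟩, rfl⟩
      exact ⟨e x, by simp⟩
    · rintro ⟨x, rfl⟩
      exact ⟨ℓ • e.symm x, ⟨e.symm x, rfl⟩, by simp⟩
  let q : (A ⧸ A.mulSubgroup) ≃+ (B ⧸ B.mulSubgroup) := QuotientAddGroup.congr _ _ e he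
  exact LinearEquiv.finrank_eq
    { q with map_smul' := fun c x => ZMod.map_smul q.toAddMonoidHom c x }

/-- The number of subgroups of `C` that are isomorphic to `A`. -/
noncomputable def sub {ℓ : ℕ} (A C : FinAbPGroup.{u} ℓ) : ℕ :=
  Nat.card {H : AddSubgroup C // Nonempty (H ≃+ A)}

theorem sub_congr {ℓ : ℕ} (A C A' C' : FinAbPGroup.{u} ℓ) (hA : A ≈ A') (hC : C ≈ C') :
    sub A C = sub A' C' := by
  obtain ⟨e⟩ := hA
  obtain ⟨f⟩ := hC
  refine Nat.card_congr (Equiv.subtypeEquiv f.mapAddSubgroup.toEquiv fun H => ?_)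
  have g : H ≃+ (f.mapAddSubgroup H) := f.addSubgroupMap H
  exact ⟨fun ⟨i⟩ => ⟨(g.symm.trans i).trans e⟩, fun ⟨i⟩ => ⟨(g.trans i).trans e.symm⟩⟩

/-- The group `A ⊕ (ℤ/ℓ)^k`. -/
def addElementary {ℓ : ℕ} [Fact ℓ.Prime] (A : FinAbPGroup.{u} ℓ) (k : ℕ) :
    FinAbPGroup.{u} ℓ where
  carrier := A × (Fin k → ZMod ℓ)
  isPGroup := by
    intro g
    obtain ⟨n, hn⟩ := A.isPGroup (Multiplicative.ofAdd (Multiplicative.toAdd g).1)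
    refine ⟨n + 1, ?_⟩
    apply Multiplicative.toAdd.injective
    have hn' : ℓ ^ n • (Multiplicative.toAdd g).1 = 0 := by
      simpa using congrArg Multiplicative.toAdd hn
    rw [toAdd_pow, toAdd_one]
    refine Prod.ext ?_ ?_
    · rw [Prod.smul_fst, pow_succ', mul_smul, hn', smul_zero, Prod.fst_zero]
    · funext i
      simp [pow_succ]

end FinAbPGroup

/-- The type `𝒢` of isomorphism classes of finite abelian `ℓ`-groups. -/
def FinAbPClass (ℓ : ℕ) : Type (u + 1) := Quotient (FinAbPGroup.isoSetoid.{u} ℓ)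

namespace FinAbPClass

/-- `[A] ≤ [B]` if and only if there is an injective homomorphism `A → B`. -/
instance (ℓ : ℕ) : LE (FinAbPClass.{u} ℓ) where
  le := Quotient.lift₂ (fun A B => ∃ f : A →+ B, Function.Injective f) (by
    rintro A B A' B' ⟨e⟩ ⟨g⟩
    refine propext ⟨?_, ?_⟩
    · rintro ⟨f, hf⟩
      exact ⟨(g.toAddMonoidHom.comp f).comp e.symm.toAddMonoidHom,
        (g.injective.comp hf).comp e.symm.injective⟩
    · rintro ⟨f, hf⟩
      exact ⟨(g.symm.toAddMonoidHom.comp f).comp e.toAddMonoidHom,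
        (g.symm.injective.comp hf).comp e.injective⟩)

instance (ℓ : ℕ) : PartialOrder (FinAbPClass.{u} ℓ) where
  le_refl A := by
    induction A using Quotient.inductionOn with
    | _ A => exact ⟨AddMonoidHom.id A, Function.injective_id⟩
  le_trans A B C := by
    induction A using Quotient.inductionOn with
    | _ A =>
    induction B using Quotient.inductionOn with
    | _ B =>
    induction C using Quotient.inductionOn with
    | _ C =>
    rintro ⟨f, hf⟩ ⟨g, hg⟩
    exact ⟨g.comp f, hg.comp hf⟩
  le_antisymm A B := by
    induction A using Quotient.inductionOn with
    | _ A =>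
    induction B using Quotient.inductionOn with
    | _ B =>
    rintro ⟨f, hf⟩ ⟨g, hg⟩
    refine Quotient.sound ⟨AddEquiv.ofBijective f ?_⟩
    exact hf.bijective_of_nat_card_le (Nat.card_le_card_of_injective g hg)

/-- The rank of a class. -/
noncomputable def rank {ℓ : ℕ} : FinAbPClass.{u} ℓ → ℕ :=
  Quotient.lift FinAbPGroup.rank FinAbPGroup.rank_congr

/-- `sub A C` is the number of subgroups of `C` that are isomorphic to `A`. -/
noncomputable def sub {ℓ : ℕ} : FinAbPClass.{u} ℓ → FinAbPClass.{u} ℓ → ℕ :=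
  Quotient.lift₂ FinAbPGroup.sub FinAbPGroup.sub_congr

/-- The class of `A ⊕ (ℤ/ℓ)^k`. -/
def addElementary {ℓ : ℕ} [Fact ℓ.Prime] (A : FinAbPClass.{u} ℓ) (k : ℕ) : FinAbPClass.{u} ℓ :=
  Quotient.map (fun X => X.addElementary k)
    (by
      rintro X Y ⟨e⟩
      exact ⟨e.prodCongr (AddEquiv.refl (Fin k → ZMod ℓ))⟩) A

theorem finite_Iic {ℓ : ℕ} (C : FinAbPClass.{u} ℓ) : (Set.Iic C).Finite := by
  induction C using Quotient.inductionOn with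
  | _ C =>
  let F : AddSubgroup C → FinAbPClass.{u} ℓ := fun H =>
    Quotient.mk _ ⟨H, C.isPGroup.to_subgroup (AddSubgroup.toSubgroup H)⟩
  refine (Set.finite_range F).subset fun B hB => ?_
  induction B using Quotient.inductionOn with
  | _ B =>
  obtain ⟨f, hf⟩ := hB
  exact ⟨f.range, Quotient.sound ⟨(AddMonoidHom.ofInjective hf).symm⟩⟩

/-- The `A`-chains with maximum `C`. An `A`-chain, that is a finite linearly ordered set of classes
`> A`, is given by the list of its elements in increasing order, `A < A₁ < ⋯ < A_i`; a nonempty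
chain has maximum `C` if the last entry of its list is `C`. -/
def chainsTo {ℓ : ℕ} (A C : FinAbPClass.{u} ℓ) : Set (List (FinAbPClass.{u} ℓ)) :=
  {l | (A :: l).Pairwise (· < ·) ∧ l.getLast? = some C}

open Classical in
/-- Passing from a list to its set of entries identifies `chainsTo A C` with the set of finite
linearly ordered subsets of `{B | A < B}` with maximum `C`. -/
theorem bijOn_chainsTo {ℓ : ℕ} (A C : FinAbPClass.{u} ℓ) :
    Set.BijOn List.toFinset (chainsTo A C)
      {s : Finset (FinAbPClass.{u} ℓ) | IsChain (· ≤ ·) (s : Set (FinAbPClass.{u} ℓ)) ∧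
        (∀ B ∈ s, A < B) ∧ IsGreatest (s : Set (FinAbPClass.{u} ℓ)) C} := by
  refine ⟨?_, ?_, ?_⟩
  · rintro l ⟨h1, h2⟩
    rw [List.pairwise_cons] at h1
    obtain ⟨h0, h3⟩ := h1
    obtain ⟨l', rfl⟩ : ∃ l', l = l' ++ [C] := List.getLast?_eq_some_iff.1 h2
    refine ⟨?_, fun B hB => h0 B (List.mem_toFinset.1 hB), ?_, fun B hB => ?_⟩
    · intro x hx y hy hxy
      rw [Finset.mem_coe, List.mem_toFinset] at hx hy
      have : Std.Symm (fun a b : FinAbPClass.{u} ℓ => a ≤ b ∨ b ≤ a) := ⟨fun _ _ h => h.symm⟩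
      have h4 : (l' ++ [C]).Pairwise (fun a b => a ≤ b ∨ b ≤ a) := h3.imp fun h => Or.inl h.le
      exact h4.forall hx hy hxy
    · simp
    · rw [Finset.mem_coe, List.mem_toFinset] at hB
      rcases List.mem_append.1 hB with h | h
      · exact ((List.pairwise_append.1 h3).2.2 B h C (by simp)).le
      · exact (List.mem_singleton.1 h).le
  · rintro l ⟨h1, _⟩ l' ⟨h1', _⟩ h
    have p : l.Pairwise (· < ·) := h1.of_cons
    have p' : l'.Pairwise (· < ·) := h1'.of_cons
    exact (List.perm_of_nodup_nodup_toFinset_eq (p.imp fun h => h.ne)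
      (p'.imp fun h => h.ne) h).eq_of_pairwise' p p'
  · intro s
    induction s using Finset.strongInduction generalizing C with
    | H s ih =>
    rintro ⟨hc, hA, hC, hmax⟩
    rw [Finset.mem_coe] at hC
    have key : ∃ l : List (FinAbPClass.{u} ℓ), (A :: l).Pairwise (· < ·) ∧
        l.toFinset = s.erase C := by
      rcases (s.erase C).eq_empty_or_nonempty with h | h
      · exact ⟨[], by simp, by simp [h]⟩
      · have hc' : IsChain (· ≤ ·) ((s.erase C : Finset _) : Set (FinAbPClass.{u} ℓ)) :=
          hc.mono (by simp)
        obtain ⟨D, hD⟩ := (s.erase C).exists_maximal h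
        have hD' : IsGreatest ((s.erase C : Finset _) : Set (FinAbPClass.{u} ℓ)) D := by
          refine ⟨hD.1, fun B hB => ?_⟩
          rcases hc'.total hB hD.1 with h | h
          · exact h
          · exact hD.2 hB h
        obtain ⟨l, hl, hl'⟩ := ih _ (Finset.erase_ssubset hC) D
          ⟨hc', fun B hB => hA B (Finset.mem_of_mem_erase hB), hD'⟩
        exact ⟨l, hl.1, hl'⟩
    obtain ⟨l, hl, hl'⟩ := key
    have hlt : ∀ B ∈ l, B < C := fun B hB => by
      have hB' : B ∈ s.erase C := hl' ▸ List.mem_toFinset.2 hB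
      exact lt_of_le_of_ne (hmax (Finset.mem_of_mem_erase hB')) (Finset.ne_of_mem_erase hB')
    refine ⟨l ++ [C], ⟨?_, by simp⟩, ?_⟩
    · rw [← List.cons_append, List.pairwise_append]
      refine ⟨hl, by simp, fun B hB D hD => ?_⟩
      rw [List.mem_singleton.1 hD]
      rcases List.mem_cons.1 hB with rfl | h
      · exact hA C hC
      · exact hlt B h
    · rw [List.toFinset_append, hl']
      ext x
      by_cases hx : x = C <;> simp [hx, hC]

theorem finite_chainsTo {ℓ : ℕ} (A C : FinAbPClass.{u} ℓ) : (chainsTo A C).Finite := by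
  classical
  refine Set.Finite.of_finite_image ?_ (bijOn_chainsTo A C).injOn
  rw [(bijOn_chainsTo A C).image_eq]
  refine Set.Finite.subset (finite_Iic C).toFinset.powerset.finite_toSet fun s hs => ?_
  rw [Finset.mem_coe, Finset.mem_powerset]
  exact fun B hB => (finite_Iic C).mem_toFinset.2 (hs.2.2.2 hB)

/-- `sub(𝔠) = (-1)^i sub(A, A₁) sub(A₁, A₂) ⋯ sub(A_{i-1}, A_i)` for the `A`-chain
`𝔠 = {A₁ < ⋯ < A_i}`. -/
noncomputable def chainSub {ℓ : ℕ} (A : FinAbPClass.{u} ℓ) (l : List (FinAbPClass.{u} ℓ)) : ℤ :=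
  (-1) ^ l.length * (List.zipWith (fun X Y => (sub X Y : ℤ)) (A :: l) l).prod

open Classical in
/-- The Möbius-type function `S` on `𝒢`. -/
noncomputable def S {ℓ : ℕ} (A C : FinAbPClass.{u} ℓ) : ℤ :=
  if ¬ A ≤ C then 0
  else if A = C then 1
  else ∑ l ∈ (finite_chainsTo A C).toFinset, chainSub A l

end FinAbPClass

/-! Write `B + j` for `B ⊕ (ℤ/ℓ)^j`. Grouping the chains by their next-to-last entry shows that `S`
is a left inverse of the matrix `sub`: `∑_D S(A,D) sub(D,C) = 0` for `A ≠ C`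
(`sum_S_mul_sub_eq_zero`). As `sub C C = 1`, this recursion determines `S A C` from the values below
`C`. It is therefore enough that the sum of `S(A,B) S(B,C)`, over the classes `B` of the same rank
as `A` with `C = B + j` for some `j`, obeys the same recursion when `rank C > rank A`
(`S_eq_sum_addElementary`). By cancellation of elementary summands at most one such `B` exists, and
the theorem follows.

After interchanging sums, the recursion for this candidate reduces to `∑_j S(B, B+j) sub(B+j, C) =
0` whenever `rank C > rank B` (`sum_S_addElementary`). Counting pairs `H ≤ K ≤ C` with `H ≅ B` and
`K ≅ B + j` in two ways gives `sub(B+j, C) sub(B, B+j) = sub(B, C) g(m, j)`, where `m = rank C -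
rank B` and `g` is a Gaussian binomial count (`sub_mul_gaussCount`). Up to the nonzero factor
`sub(B, B+m)`, the case `C = B + m` thus decides every `C` with the same `m`. In that case the sum
is the recursion for `S(B, B+m)` itself, because the interval from `B` to `B + m` consists only of
classes `B + j`. -/

/-! ### Splitting off and cancelling elementary abelian summands -/

section Groups

variable {M N : Type*} [AddCommGroup M] [AddCommGroup N] {p : ℕ}

/-- The subgroup of elements killed by `p`. -/
def torsionKer (p : ℕ) (M : Type*) [AddCommGroup M] : AddSubgroup M :=
  (nsmulAddMonoidHom (α := M) p).ker

theorem mem_torsionKer {x : M} : x ∈ torsionKer p M ↔ p • x = 0 := Iff.rfl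

theorem AddMonoidHom.card_range_mul_card_ker (f : M →+ N) :
    Nat.card f.range * Nat.card f.ker = Nat.card M := by
  rw [← AddSubgroup.index_ker, AddSubgroup.index_mul_card]

theorem card_torsionKer_prod :
    Nat.card (torsionKer p (M × N)) = Nat.card (torsionKer p M) * Nat.card (torsionKer p N) := by
  rw [← Nat.card_prod]
  refine Nat.card_congr
    { toFun := fun x => (⟨x.1.1, congrArg Prod.fst x.2⟩, ⟨x.1.2, congrArg Prod.snd x.2⟩)
      invFun := fun x => ⟨(x.1.1, x.2.1), Prod.ext x.1.2 x.2.2⟩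
      left_inv := fun x => rfl
      right_inv := fun x => rfl }

theorem card_torsionKer_congr (e : M ≃+ N) :
    Nat.card (torsionKer p M) = Nat.card (torsionKer p N) := by
  refine Nat.card_congr (e.toEquiv.subtypeEquiv fun x => ?_)
  change p • x = 0 ↔ p • e x = 0
  rw [← map_nsmul, map_eq_zero_iff e e.injective]

theorem card_torsionKer_of_smul_eq_zero (h : ∀ x : M, p • x = 0) :
    Nat.card (torsionKer p M) = Nat.card M := by
  rw [(AddSubgroup.eq_top_iff' (torsionKer p M)).2 h]
  exact Nat.card_congr AddSubgroup.topEquiv.toEquiv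

theorem smul_pi_zmod_eq_zero (j : ℕ) (x : Fin j → ZMod p) : p • x = 0 := by
  funext i; simp

theorem card_pi_zmod (j : ℕ) : Nat.card (Fin j → ZMod p) = p ^ j := by
  simp [Nat.card_pi]

theorem nonempty_addEquiv_pi_zmod_of_module [Fact p.Prime] [Finite M] [Module (ZMod p) M] {j : ℕ}
    (hc : Nat.card M = p ^ j) : Nonempty (M ≃+ (Fin j → ZMod p)) := by
  have hfin : Module.Finite (ZMod p) M := Module.Finite.of_finite
  have h1 : Module.finrank (ZMod p) M = j := by
    have := Module.natCard_eq_pow_finrank (K := ZMod p) (V := M)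
    rw [hc, Nat.card_zmod] at this
    exact (Nat.pow_right_injective (Fact.out : p.Prime).two_le this).symm
  exact ⟨(LinearEquiv.ofFinrankEq M (Fin j → ZMod p) (by rw [h1, Module.finrank_fin_fun])).toAddEquiv⟩

theorem nonempty_addEquiv_pi_zmod [Fact p.Prime] [Finite M] (h : ∀ x : M, p • x = 0) {j : ℕ}
    (hc : Nat.card M = p ^ j) : Nonempty (M ≃+ (Fin j → ZMod p)) := by
  let _ : Module (ZMod p) M := AddCommGroup.zmodModule h
  exact nonempty_addEquiv_pi_zmod_of_module hc

theorem AddSubgroup.nonempty_addEquiv_prod_of_isCompl {H W : AddSubgroup M} (h : IsCompl H W) :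
    Nonempty (M ≃+ H × W) :=
  ⟨(Submodule.prodEquivOfIsCompl (AddSubgroup.toIntSubmodule H) (AddSubgroup.toIntSubmodule W)
    ((AddSubgroup.toIntSubmodule (M := M)).isCompl h)).symm.toAddEquiv⟩

theorem AddSubgroup.nonempty_addEquiv_of_isCompl_of_isCompl {H H' W : AddSubgroup M}
    (h : IsCompl H W) (h' : IsCompl H' W) : Nonempty (H ≃+ H') :=
  ⟨((Submodule.quotientEquivOfIsCompl (AddSubgroup.toIntSubmodule W) (AddSubgroup.toIntSubmodule H)
      ((AddSubgroup.toIntSubmodule (M := M)).isCompl h.symm)).symm.trans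
    (Submodule.quotientEquivOfIsCompl (AddSubgroup.toIntSubmodule W)
      (AddSubgroup.toIntSubmodule H')
      ((AddSubgroup.toIntSubmodule (M := M)).isCompl h'.symm))).toAddEquiv⟩

/-- `M[p]` is an `𝔽_p`-vector space, so `H ∩ M[p]` has a complement `W` in it; since `H` and `M[p]`
span `M`, this `W` is a complement of `H` in all of `M`. -/
theorem exists_isCompl_of_sup_torsionKer_eq_top [Fact p.Prime] {H : AddSubgroup M}
    (h : H ⊔ torsionKer p M = ⊤) : ∃ W ≤ torsionKer p M, IsCompl H W := by
  let _ : Module (ZMod p) (torsionKer p M) :=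
    AddCommGroup.zmodModule fun x => Subtype.ext x.2
  obtain ⟨W, hW⟩ : ∃ W, IsCompl (H.addSubgroupOf (torsionKer p M)) W := by
    obtain ⟨W, hW⟩ := exists_isCompl
      (AddSubgroup.toZModSubmodule p (H.addSubgroupOf (torsionKer p M)))
    exact ⟨W.toAddSubgroup, (AddSubgroup.toZModSubmodule p).symm.isCompl hW⟩
  refine ⟨W.map (torsionKer p M).subtype, ?_, ?_, ?_⟩
  · rintro _ ⟨x, -, rfl⟩
    exact x.2
  · rw [AddSubgroup.disjoint_def]
    rintro _ hx ⟨x, hxW, rfl⟩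
    exact congrArg Subtype.val (AddSubgroup.disjoint_def.1 hW.disjoint (x := x) hx hxW)
  · rw [codisjoint_iff, eq_top_iff, ← h]
    refine sup_le le_sup_left fun x hx => ?_
    have hx' : (⟨x, hx⟩ : torsionKer p M) ∈ H.addSubgroupOf (torsionKer p M) ⊔ W := by
      rw [hW.sup_eq_top]; trivial
    obtain ⟨a, ha, b, hb, hab⟩ := AddSubgroup.mem_sup.1 hx'
    exact AddSubgroup.mem_sup.2 ⟨a, ha, b, ⟨b, hb, rfl⟩, congrArg Subtype.val hab⟩

theorem nonempty_addEquiv_prod_pi_of_sup_torsionKer_eq_top [Fact p.Prime] [Finite M]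
    {H : AddSubgroup M} (h : H ⊔ torsionKer p M = ⊤) {j : ℕ}
    (hc : Nat.card M = Nat.card H * p ^ j) : Nonempty (M ≃+ H × (Fin j → ZMod p)) := by
  obtain ⟨W, hW, hcompl⟩ := exists_isCompl_of_sup_torsionKer_eq_top h
  obtain ⟨e⟩ := AddSubgroup.nonempty_addEquiv_prod_of_isCompl hcompl
  have hcW : Nat.card W = p ^ j := by
    rw [Nat.card_congr e.toEquiv, Nat.card_prod] at hc
    exact Nat.eq_of_mul_eq_mul_left Nat.card_pos hc
  obtain ⟨g⟩ := nonempty_addEquiv_pi_zmod (p := p) (M := W)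
    (fun x => Subtype.ext (hW x.2)) hcW
  exact ⟨e.trans ((AddEquiv.refl H).prodCongr g)⟩

theorem sup_torsionKer_eq_top_of_range_le {H : AddSubgroup M}
    (h : (nsmulAddMonoidHom (α := M) p).range ≤ H.map (nsmulAddMonoidHom p)) :
    H ⊔ torsionKer p M = ⊤ := by
  rw [eq_top_iff]
  intro x _
  obtain ⟨y, hy, hxy⟩ := h ⟨x, rfl⟩
  refine AddSubgroup.mem_sup.2 ⟨y, hy, x - y, ?_, by abel⟩
  change nsmulAddMonoidHom p (x - y) = 0
  rw [map_sub, hxy, sub_self]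

theorem card_map_nsmul_mul (H : AddSubgroup M) :
    Nat.card (H.map (nsmulAddMonoidHom (α := M) p)) * Nat.card (torsionKer p H) = Nat.card H := by
  rw [← AddMonoidHom.card_range_mul_card_ker (nsmulAddMonoidHom (α := H) p)]
  congr 1
  refine Nat.card_congr (Equiv.symm ((AddEquiv.toEquiv
    (AddSubgroup.equivMapOfInjective _ H.subtype H.subtype_injective)).trans (Equiv.setCongr ?_)))
  ext x
  constructor
  · rintro ⟨_, ⟨y, rfl⟩, rfl⟩
    exact ⟨y, y.2, rfl⟩
  · rintro ⟨y, hy, rfl⟩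
    exact ⟨_, ⟨⟨y, hy⟩, rfl⟩, rfl⟩

/-- If `M ≅ H ⊕ (ℤ/p)^j` abstractly for a subgroup `H` of `M`, then `M = H + M[p]`. -/
theorem sup_torsionKer_eq_top_of_addEquiv [Fact p.Prime] [Finite M] {H : AddSubgroup M}
    {X : Type*} [AddCommGroup X] (f : H ≃+ X) {j : ℕ} (e : M ≃+ X × (Fin j → ZMod p)) :
    H ⊔ torsionKer p M = ⊤ := by
  apply sup_torsionKer_eq_top_of_range_le
  have h1 := card_map_nsmul_mul (p := p) H
  -- Both `|M|` and `|M[p]|` are `p ^ j` times the corresponding numbers for `H`, so `|pM| = |pH|`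
  -- and hence `pM = pH`.
  have h2 : Nat.card (nsmulAddMonoidHom (α := M) p).range * Nat.card (torsionKer p M) =
      Nat.card M := AddMonoidHom.card_range_mul_card_ker _
  rw [card_torsionKer_congr e, card_torsionKer_prod, ← card_torsionKer_congr f,
    card_torsionKer_of_smul_eq_zero (smul_pi_zmod_eq_zero (p := p) j), Nat.card_congr e.toEquiv,
    Nat.card_prod, ← Nat.card_congr f.toEquiv, ← h1, ← mul_assoc] at h2
  have h3 := Nat.eq_of_mul_eq_mul_right Nat.card_pos (Nat.eq_of_mul_eq_mul_right (by
    rw [card_pi_zmod]; exact pow_pos (Fact.out : p.Prime).pos j) h2)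
  have h4 : H.map (nsmulAddMonoidHom (α := M) p) ≤ (nsmulAddMonoidHom (α := M) p).range := by
    rintro _ ⟨x, -, rfl⟩
    exact ⟨x, rfl⟩
  exact (AddSubgroup.eq_of_le_of_card_ge h4 h3.le).ge

theorem isCompl_zmultiples_of_index_eq_prime [Fact p.Prime] {H : AddSubgroup M}
    (hH : H.index = p) {w : M} (hw : p • w = 0) (hwH : w ∉ H) :
    IsCompl H (AddSubgroup.zmultiples w) := by
  have hp : p.Prime := Fact.out
  constructor
  · rw [AddSubgroup.disjoint_def]
    rintro _ hx ⟨n, rfl⟩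
    by_cases hn : (p : ℤ) ∣ n
    · obtain ⟨m, rfl⟩ := hn
      change ((p : ℤ) * m) • w = 0
      rw [mul_comm, mul_smul, natCast_zsmul, hw, smul_zero]
    · obtain ⟨a, b, hab⟩ := (Nat.prime_iff_prime_int.1 hp).coprime_iff_not_dvd.2 hn
      refine absurd ?_ hwH
      have : w = b • (n • w) := by
        conv_lhs => rw [← one_smul ℤ w, ← hab, add_smul, mul_smul, natCast_zsmul, hw, smul_zero,
          zero_add, mul_smul]
      rw [this]
      exact H.zsmul_mem hx b
  · rw [codisjoint_iff]
    have h1 : (H ⊔ AddSubgroup.zmultiples w).index ∣ p :=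
      hH ▸ AddSubgroup.index_dvd_of_le le_sup_left
    rcases (Nat.dvd_prime hp).1 h1 with h | h
    · exact AddSubgroup.index_eq_one.1 h
    · exfalso
      have h2 := AddSubgroup.relIndex_mul_index (H := H) (K := H ⊔ AddSubgroup.zmultiples w)
        le_sup_left
      rw [h, hH] at h2
      have h3 : H.relIndex (H ⊔ AddSubgroup.zmultiples w) = 1 :=
        Nat.eq_of_mul_eq_mul_right hp.pos (by rw [h2, one_mul])
      exact hwH (AddSubgroup.relIndex_eq_one.1 h3
        (AddSubgroup.mem_sup_right (AddSubgroup.mem_zmultiples w)))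

/-- Neither subgroup contains `M[p]`, and a group is not the union of two proper subgroups, so some
`w ∈ M[p]` avoids both. Then `⟨w⟩` is a common complement, and both subgroups are isomorphic to `M /
⟨w⟩`. -/
theorem nonempty_addEquiv_of_index_eq_prime [Fact p.Prime] {H H' : AddSubgroup M}
    (hH : H.index = p) (hH' : H'.index = p) (h : H ⊔ torsionKer p M = ⊤)
    (h' : H' ⊔ torsionKer p M = ⊤) : Nonempty (H ≃+ H') := by
  have hp : p.Prime := Fact.out
  have key : ∀ K : AddSubgroup M, K.index = p → K ⊔ torsionKer p M = ⊤ →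
      ∃ x, p • x = 0 ∧ x ∉ K := by
    intro K hK hK'
    by_contra! hc
    have : torsionKer p M ≤ K := fun x hx => hc x hx
    rw [sup_eq_left.2 this] at hK'
    rw [hK', AddSubgroup.index_top] at hK
    exact hp.one_lt.ne hK
  have : ∃ w, p • w = 0 ∧ w ∉ H ∧ w ∉ H' := by
    obtain ⟨x, hx, hxH⟩ := key H hH h
    obtain ⟨y, hy, hyH⟩ := key H' hH' h'
    by_cases h1 : x ∈ H'
    · by_cases h2 : y ∈ H
      · refine ⟨x + y, by rw [smul_add, hx, hy, add_zero], ?_, ?_⟩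
        · rwa [AddSubgroup.add_mem_cancel_right _ h2]
        · rwa [AddSubgroup.add_mem_cancel_left _ h1]
      · exact ⟨y, hy, h2, hyH⟩
    · exact ⟨x, hx, hxH, h1⟩
  obtain ⟨w, hw, hwH, hwH'⟩ := this
  exact AddSubgroup.nonempty_addEquiv_of_isCompl_of_isCompl
    (isCompl_zmultiples_of_index_eq_prime hH hw hwH)
    (isCompl_zmultiples_of_index_eq_prime hH' hw hwH')

theorem sup_torsionKer_fst {Z : Type*} [AddCommGroup Z] (hZ : ∀ z : Z, p • z = 0)
    (e : N ≃+ M × Z) :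
    ((e.symm : M × Z →+ N).comp (AddMonoidHom.inl M Z)).range ⊔ torsionKer p N = ⊤ := by
  rw [eq_top_iff]
  intro x _
  refine AddSubgroup.mem_sup.2 ⟨e.symm ((e x).1, 0), ⟨_, rfl⟩, e.symm (0, (e x).2), ?_, ?_⟩
  · change p • e.symm _ = 0
    rw [← map_nsmul, map_eq_zero_iff _ e.symm.injective, Prod.smul_mk, hZ, smul_zero]
    rfl
  · rw [← map_add]; simp

theorem index_range_inl {Z : Type*} [AddCommGroup Z] [Finite N] (e : N ≃+ M × Z) :
    ((e.symm : M × Z →+ N).comp (AddMonoidHom.inl M Z)).range.index = Nat.card Z := by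
  have hinj : Function.Injective ((e.symm : M × Z →+ N).comp (AddMonoidHom.inl M Z)) :=
    e.symm.injective.comp (fun x y h => congrArg Prod.fst h)
  have h1 := ((e.symm : M × Z →+ N).comp (AddMonoidHom.inl M Z)).range.card_mul_index
  rw [← Nat.card_congr (AddMonoidHom.ofInjective hinj).toEquiv, Nat.card_congr e.toEquiv,
    Nat.card_prod] at h1
  have : Finite M := Finite.of_injective _ hinj
  exact Nat.eq_of_mul_eq_mul_left Nat.card_pos h1

theorem nonempty_addEquiv_of_prod_prime {X Y Z : Type*} [AddCommGroup X] [AddCommGroup Y]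
    [AddCommGroup Z] [Finite X] [Fact p.Prime] (hZ : ∀ z : Z, p • z = 0) (hc : Nat.card Z = p)
    (e : X × Z ≃+ Y × Z) : Nonempty (X ≃+ Y) := by
  have : Finite Z := Nat.finite_of_card_ne_zero (hc ▸ (Fact.out : p.Prime).ne_zero)
  obtain ⟨f⟩ := nonempty_addEquiv_of_index_eq_prime (p := p)
    ((index_range_inl (AddEquiv.refl (X × Z))).trans hc) ((index_range_inl e).trans hc)
    (sup_torsionKer_fst hZ _) (sup_torsionKer_fst hZ e)
  refine ⟨((AddMonoidHom.ofInjective (f := ((AddEquiv.refl (X × Z)).symm : X × Z →+ X × Z).comp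
    (AddMonoidHom.inl X Z)) ?_).trans f).trans (AddMonoidHom.ofInjective ?_).symm⟩
  · exact fun x y h => congrArg Prod.fst h
  · exact e.symm.injective.comp (fun x y h => congrArg Prod.fst h)

theorem nonempty_addEquiv_of_prod_pi_zmod {X Y : Type*} [AddCommGroup X] [AddCommGroup Y]
    [Finite X] [Fact p.Prime] (j : ℕ) (e : X × (Fin j → ZMod p) ≃+ Y × (Fin j → ZMod p)) :
    Nonempty (X ≃+ Y) := by
  induction j with
  | zero => exact ⟨(AddEquiv.prodUnique.symm.trans e).trans AddEquiv.prodUnique⟩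
  | succ j ih =>
    let c : (Fin (j + 1) → ZMod p) ≃+ (Fin j → ZMod p) × ZMod p :=
      { (Fin.snocEquiv fun _ : Fin (j + 1) => ZMod p).symm.trans (Equiv.prodComm _ _) with
        map_add' := fun x y => rfl }
    let cX : X × (Fin (j + 1) → ZMod p) ≃+ (X × (Fin j → ZMod p)) × ZMod p :=
      ((AddEquiv.refl X).prodCongr c).trans AddEquiv.prodAssoc.symm
    let cY : Y × (Fin (j + 1) → ZMod p) ≃+ (Y × (Fin j → ZMod p)) × ZMod p :=
      ((AddEquiv.refl Y).prodCongr c).trans AddEquiv.prodAssoc.symm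
    obtain ⟨f⟩ := nonempty_addEquiv_of_prod_prime (p := p) (Z := ZMod p) (by simp) (by simp)
      ((cX.symm.trans e).trans cY)
    exact ih f

/-! ### Counting split overgroups of a subgroup -/

/-- The number of subgroups of order `p ^ j` of `(ℤ/p)^m`. -/
noncomputable def gaussCount (p m j : ℕ) : ℕ :=
  Nat.card {L : AddSubgroup (Fin m → ZMod p) // Nat.card L = p ^ j}

theorem card_subgroups_congr (e : M ≃+ N) (n : ℕ) :
    Nat.card {L : AddSubgroup M // Nat.card L = n} =
      Nat.card {L : AddSubgroup N // Nat.card L = n} := by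
  refine Nat.card_congr (Equiv.subtypeEquiv e.mapAddSubgroup.toEquiv fun L => ?_)
  have g : L ≃+ (e.mapAddSubgroup L) := e.addSubgroupMap L
  change _ ↔ Nat.card (e.mapAddSubgroup L) = n
  rw [Nat.card_congr g.toEquiv]

theorem exists_nonempty_addEquiv_prod_pi_of_sup_torsionKer_eq_top [Fact p.Prime] [Finite M]
    {H : AddSubgroup M} (h : H ⊔ torsionKer p M = ⊤) :
    ∃ j, Nonempty (M ≃+ H × (Fin j → ZMod p)) := by
  obtain ⟨W, hW, hcompl⟩ := exists_isCompl_of_sup_torsionKer_eq_top h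
  obtain ⟨e⟩ := AddSubgroup.nonempty_addEquiv_prod_of_isCompl hcompl
  have hW' : ∀ x : W, p • x = 0 := fun x => Subtype.ext (hW x.2)
  obtain ⟨j, hj⟩ : ∃ j, Nat.card W = p ^ j := by
    have : IsPGroup p (Multiplicative W) := fun g => ⟨1, by
      rw [pow_one]; exact hW' (Multiplicative.toAdd g)⟩
    exact (IsPGroup.iff_card (G := Multiplicative W)).1 this
  obtain ⟨g⟩ := nonempty_addEquiv_pi_zmod hW' hj
  exact ⟨j, ⟨e.trans ((AddEquiv.refl H).prodCongr g)⟩⟩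

theorem card_map_mk'_mul_card {H K : AddSubgroup M} (h : H ≤ K) :
    Nat.card (K.map (QuotientAddGroup.mk' H)) * Nat.card H = Nat.card K := by
  rw [← AddSubgroup.relIndex_ker, QuotientAddGroup.ker_mk', AddSubgroup.relIndex,
    ← AddSubgroup.index_mul_card (H.addSubgroupOf K),
    Nat.card_congr (AddSubgroup.addSubgroupOfEquivOfLe h).toEquiv]

theorem map_mk'_le_iff {H K T : AddSubgroup M} :
    K.map (QuotientAddGroup.mk' H) ≤ T.map (QuotientAddGroup.mk' H) ↔ K ≤ H ⊔ T := by
  rw [AddSubgroup.map_le_iff_le_comap, AddSubgroup.comap_map_eq, QuotientAddGroup.ker_mk',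
    sup_comm]

theorem addSubgroupOf_sup_torsionKer_eq_top {H K : AddSubgroup M} (h : H ≤ K) :
    H.addSubgroupOf K ⊔ torsionKer p K = ⊤ ↔ K ≤ H ⊔ torsionKer p M := by
  constructor
  · intro h1 x hx
    have h2 : (⟨x, hx⟩ : K) ∈ H.addSubgroupOf K ⊔ torsionKer p K := by rw [h1]; trivial
    obtain ⟨a, ha, b, hb, hab⟩ := AddSubgroup.mem_sup.1 h2
    exact AddSubgroup.mem_sup.2 ⟨a, ha, b, congrArg Subtype.val hb, congrArg Subtype.val hab⟩
  · intro h1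
    rw [eq_top_iff]
    rintro ⟨x, hx⟩ -
    obtain ⟨a, ha, b, hb, hab⟩ := AddSubgroup.mem_sup.1 (h1 hx)
    have hbK : b ∈ K := by
      rw [← hab] at hx
      exact (K.add_mem_cancel_left (h ha)).1 hx
    exact AddSubgroup.mem_sup.2 ⟨⟨a, h ha⟩, ha, ⟨b, hbK⟩, Subtype.ext hb, Subtype.ext hab⟩

/-- An abstract isomorphism already forces `K = H + K[p]`, whatever the position of `H` in `K`. The
isomorphism type of `K` can thus be read off in `M / H`, inside the image of `M[p]`. -/
theorem nonempty_addEquiv_prod_pi_iff [Fact p.Prime] [Finite M] {H K : AddSubgroup M} (h : H ≤ K)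
    {X : Type*} [AddCommGroup X] (f : H ≃+ X) (j : ℕ) :
    Nonempty (K ≃+ X × (Fin j → ZMod p)) ↔
      K.map (QuotientAddGroup.mk' H) ≤ (torsionKer p M).map (QuotientAddGroup.mk' H) ∧
        Nat.card (K.map (QuotientAddGroup.mk' H)) = p ^ j := by
  rw [map_mk'_le_iff, ← addSubgroupOf_sup_torsionKer_eq_top h]
  have f' : H.addSubgroupOf K ≃+ H := AddSubgroup.addSubgroupOfEquivOfLe h
  have hc := card_map_mk'_mul_card h
  constructor
  · rintro ⟨e⟩
    refine ⟨sup_torsionKer_eq_top_of_addEquiv (f'.trans f) e, ?_⟩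
    rw [Nat.card_congr e.toEquiv, Nat.card_prod, card_pi_zmod, Nat.card_congr f.toEquiv,
      mul_comm] at hc
    have : 0 < Nat.card X := by
      rw [← Nat.card_congr f.toEquiv]; exact Nat.card_pos
    exact Nat.eq_of_mul_eq_mul_left this hc
  · rintro ⟨h1, h2⟩
    obtain ⟨e⟩ := nonempty_addEquiv_prod_pi_of_sup_torsionKer_eq_top (j := j) h1 (by
      rw [← hc, h2, Nat.card_congr f'.toEquiv, mul_comm])
    exact ⟨e.trans ((f'.trans f).prodCongr (AddEquiv.refl _))⟩

theorem card_torsionKer_map_mk'_mul (H : AddSubgroup M) :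
    Nat.card ((torsionKer p M).map (QuotientAddGroup.mk' H)) * Nat.card (torsionKer p H) =
      Nat.card (torsionKer p M) := by
  rw [← AddSubgroup.relIndex_ker, QuotientAddGroup.ker_mk', AddSubgroup.relIndex,
    ← AddSubgroup.index_mul_card (H.addSubgroupOf (torsionKer p M))]
  congr 1
  exact Nat.card_congr
    { toFun := fun x => ⟨⟨x.1.1, congrArg Subtype.val x.2⟩, x.1.2⟩
      invFun := fun x => ⟨⟨x.1.1, x.2⟩, Subtype.ext x.1.2⟩
      left_inv := fun x => rfl
      right_inv := fun x => rfl }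

/-- The overgroups of `H` that split as `H ⊕ (ℤ/p)^j` correspond to the subgroups of order `p ^ j`
of an elementary abelian group. -/
theorem card_overgroups [Fact p.Prime] [Finite M] {H : AddSubgroup M} {X : Type*}
    [AddCommGroup X] (f : H ≃+ X) {m : ℕ}
    (hm : p ^ m * Nat.card (torsionKer p H) = Nat.card (torsionKer p M)) (j : ℕ) :
    Nat.card {K : AddSubgroup M // H ≤ K ∧ Nonempty (K ≃+ X × (Fin j → ZMod p))} =
      gaussCount p m j := by
  set π := QuotientAddGroup.mk' H with hπ
  set Q := (torsionKer p M).map π with hQ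
  have hker : π.ker = H := QuotientAddGroup.ker_mk' H
  have hsurj : Function.Surjective π := QuotientAddGroup.mk'_surjective H
  have hQc : Nat.card Q = p ^ m := by
    rw [← card_torsionKer_map_mk'_mul H] at hm
    exact (Nat.eq_of_mul_eq_mul_right Nat.card_pos hm).symm
  have hQt : ∀ x : Q, p • x = 0 := by
    rintro ⟨_, x, hx, rfl⟩
    refine Subtype.ext ?_
    change p • π x = 0
    rw [← map_nsmul, mem_torsionKer.1 hx, map_zero]
  obtain ⟨e⟩ := nonempty_addEquiv_pi_zmod hQt hQc
  rw [gaussCount, ← card_subgroups_congr e]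
  have hmap : ∀ L : AddSubgroup Q,
      ((L.map Q.subtype).comap π).map π = L.map Q.subtype := fun L =>
    AddSubgroup.map_comap_eq_self_of_surjective hsurj _
  have hle : ∀ L : AddSubgroup Q, H ≤ (L.map Q.subtype).comap π := fun L =>
    hker.ge.trans (AddSubgroup.ker_le_comap _ _)
  have hcard : ∀ L : AddSubgroup Q, Nat.card (L.map Q.subtype) = Nat.card L := fun L =>
    (Nat.card_congr (L.equivMapOfInjective Q.subtype Q.subtype_injective).toEquiv).symm
  symm
  -- The overgroups in question are the preimages under `π` of the subgroups of `Q`, the image of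
  -- `M[p]` in `M / H`.
  refine Nat.card_congr (Equiv.ofBijective
    (fun L => ⟨(L.1.map Q.subtype).comap π, hle L.1,
      (nonempty_addEquiv_prod_pi_iff (hle L.1) f j).2 ⟨?_, ?_⟩⟩) ⟨?_, ?_⟩)
  · rw [← hπ, hmap]
    rintro _ ⟨x, -, rfl⟩
    exact x.2
  · rw [← hπ, hmap, hcard, L.2]
  · rintro ⟨L, hL⟩ ⟨L', hL'⟩ h
    have h1 := congrArg (AddSubgroup.map π) (congrArg Subtype.val h)
    rw [hmap, hmap] at h1
    exact Subtype.ext (AddSubgroup.map_injective Q.subtype_injective h1)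
  · rintro ⟨K, hHK, hK⟩
    obtain ⟨h1, h2⟩ := (nonempty_addEquiv_prod_pi_iff hHK f j).1 hK
    have h3 : ((K.map π).addSubgroupOf Q).map Q.subtype = K.map π := by
      rw [AddSubgroup.addSubgroupOf_map_subtype]
      exact inf_eq_left.2 h1
    refine ⟨⟨(K.map π).addSubgroupOf Q, ?_⟩, Subtype.ext ?_⟩
    · rw [← hcard, h3]; exact h2
    · change (((K.map π).addSubgroupOf Q).map Q.subtype).comap π = K
      rw [h3, AddSubgroup.comap_map_eq, hker, sup_eq_left.2 hHK]

end Groups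

theorem Nat.card_mul_eq_card_mul_of_fibers {α β : Type*} [Finite α] [Finite β] {P : α → Prop}
    {Q : β → Prop} {R : α → β → Prop} {m n : ℕ}
    (hm : ∀ a, P a → Nat.card {b // R a b ∧ Q b} = m)
    (hn : ∀ b, Q b → Nat.card {a // R a b ∧ P a} = n) :
    Nat.card {a // P a} * m = Nat.card {b // Q b} * n := by
  classical
  have : Fintype {a // P a} := Fintype.ofFinite _
  have : Fintype {b // Q b} := Fintype.ofFinite _
  have h1 : Nat.card (Σ a : {a // P a}, {b // R a.1 b ∧ Q b}) = Nat.card {a // P a} * m := by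
    rw [Nat.card_sigma, Finset.sum_congr rfl fun (a : {a // P a}) _ => hm a.1 a.2]
    simp
  have h2 : Nat.card (Σ b : {b // Q b}, {a // R a b.1 ∧ P a}) = Nat.card {b // Q b} * n := by
    rw [Nat.card_sigma, Finset.sum_congr rfl fun (b : {b // Q b}) _ => hn b.1 b.2]
    simp
  rw [← h1, ← h2]
  exact Nat.card_congr
    { toFun := fun x => ⟨⟨x.2.1, x.2.2.2⟩, ⟨x.1.1, x.2.2.1, x.1.2⟩⟩
      invFun := fun x => ⟨⟨x.2.1, x.2.2.2⟩, ⟨x.1.1, x.2.2.1, x.1.2⟩⟩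
      left_inv := fun x => rfl
      right_inv := fun x => rfl }

/-! ### Rank and subgroup counts for finite abelian `ℓ`-groups -/

namespace FinAbPGroup

variable {ℓ : ℕ}

/-- Both `|A/ℓA|` and `|A[ℓ]|` equal `|A| / |ℓA|`. Unlike the quotient, the torsion is visibly
monotone under injections. -/
theorem pow_rank [Fact ℓ.Prime] (A : FinAbPGroup.{u} ℓ) :
    ℓ ^ A.rank = Nat.card (torsionKer ℓ A) := by
  have h1 : Nat.card (A ⧸ A.mulSubgroup) = ℓ ^ A.rank := by
    have hfin : Module.Finite (ZMod ℓ) (A ⧸ A.mulSubgroup) := Module.Finite.of_finite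
    rw [Module.natCard_eq_pow_finrank (K := ZMod ℓ) (V := A ⧸ A.mulSubgroup), Nat.card_zmod, rank]
  have h2 := AddSubgroup.card_eq_card_quotient_mul_card_addSubgroup A.mulSubgroup
  rw [h1, ← AddMonoidHom.card_range_mul_card_ker (nsmulAddMonoidHom (α := A) ℓ), mul_comm] at h2
  exact (Nat.eq_of_mul_eq_mul_right Nat.card_pos h2).symm

/-- A subgroup of a finite abelian `ℓ`-group. -/
def ofSubgroup (C : FinAbPGroup.{u} ℓ) (H : AddSubgroup C) : FinAbPGroup.{u} ℓ :=
  ⟨H, C.isPGroup.to_subgroup (AddSubgroup.toSubgroup H)⟩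

theorem card_subgroups_le_eq_sub (B C : FinAbPGroup.{u} ℓ) (K : AddSubgroup C) :
    Nat.card {H : AddSubgroup C // H ≤ K ∧ Nonempty (H ≃+ B)} = sub B (C.ofSubgroup K) := by
  symm
  have heq : ∀ H : AddSubgroup K, Nonempty (H ≃+ H.map K.subtype) := fun H =>
    ⟨H.equivMapOfInjective K.subtype K.subtype_injective⟩
  refine Nat.card_congr (Equiv.ofBijective
    (fun H : {H : AddSubgroup K // Nonempty (H ≃+ B)} =>
      (⟨H.1.map K.subtype, ?_, ?_⟩ : {H : AddSubgroup C // H ≤ K ∧ Nonempty (H ≃+ B)})) ⟨?_, ?_⟩)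
  · rintro _ ⟨x, -, rfl⟩
    exact x.2
  · obtain ⟨e⟩ := heq H.1
    obtain ⟨f⟩ := H.2
    exact ⟨e.symm.trans f⟩
  · intro H H' h
    exact Subtype.ext (AddSubgroup.map_injective K.subtype_injective (congrArg Subtype.val h))
  · rintro ⟨H, hHK, ⟨e⟩⟩
    refine ⟨⟨H.addSubgroupOf K, ⟨(AddSubgroup.addSubgroupOfEquivOfLe hHK).trans e⟩⟩,
      Subtype.ext ?_⟩
    change (H.addSubgroupOf K).map K.subtype = H
    rw [AddSubgroup.addSubgroupOf_map_subtype, inf_eq_left.2 hHK]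

theorem rank_le_of_injective [Fact ℓ.Prime] {A B : FinAbPGroup.{u} ℓ} (f : A →+ B)
    (hf : Function.Injective f) : A.rank ≤ B.rank := by
  refine (Nat.pow_le_pow_iff_right (Fact.out : ℓ.Prime).one_lt).1 ?_
  rw [pow_rank, pow_rank]
  refine Nat.card_le_card_of_injective
    (fun x : torsionKer ℓ A => (⟨f x, ?_⟩ : torsionKer ℓ B)) fun x y h => ?_
  · rw [mem_torsionKer, ← map_nsmul, mem_torsionKer.1 x.2, map_zero]
  · exact Subtype.ext (hf (congrArg Subtype.val h))

theorem rank_addElementary [Fact ℓ.Prime] (B : FinAbPGroup.{u} ℓ) (j : ℕ) :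
    (B.addElementary j).rank = B.rank + j := by
  refine Nat.pow_right_injective (Fact.out : ℓ.Prime).two_le ?_
  change ℓ ^ _ = ℓ ^ _
  rw [pow_rank, pow_add, pow_rank]
  change Nat.card (torsionKer ℓ (B × (Fin j → ZMod ℓ))) = _
  rw [card_torsionKer_prod, card_torsionKer_of_smul_eq_zero (smul_pi_zmod_eq_zero (p := ℓ) j),
    card_pi_zmod]

/-- Counting the pairs `H ≤ K ≤ C` with `H ≅ B` and `K ≅ B ⊕ (ℤ/ℓ)^j` in two ways. -/
theorem sub_mul_gaussCount [Fact ℓ.Prime] (B C : FinAbPGroup.{u} ℓ) (j : ℕ) :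
    sub B C * gaussCount ℓ (C.rank - B.rank) j =
      sub (B.addElementary j) C * sub B (B.addElementary j) := by
  refine Nat.card_mul_eq_card_mul_of_fibers (R := fun H K : AddSubgroup C => H ≤ K) ?_ ?_
  · rintro H ⟨e⟩
    -- The image of `C[ℓ]` in `C / H` has order `|C[ℓ]| / |H[ℓ]|`, whose exponent is the difference
    -- of the ranks.
    refine card_overgroups e ?_ j
    have h : B.rank ≤ C.rank := rank_le_of_injective (H.subtype.comp (e.symm : B →+ H))
      (H.subtype_injective.comp e.symm.injective)
    rw [card_torsionKer_congr e, ← pow_rank, ← pow_rank, ← pow_add, Nat.sub_add_cancel h]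
  · rintro K ⟨e⟩
    rw [card_subgroups_le_eq_sub]
    exact sub_congr _ _ _ _ (Setoid.refl B) ⟨e⟩

theorem sub_self (C : FinAbPGroup.{u} ℓ) : sub C C = 1 := by
  rw [sub, Nat.card_eq_one_iff_unique]
  refine ⟨⟨?_⟩, ⟨⟨⊤, ⟨AddSubgroup.topEquiv⟩⟩⟩⟩
  have h : ∀ H : AddSubgroup C, Nonempty (H ≃+ C) → H = ⊤ := by
    rintro H ⟨e⟩
    exact AddSubgroup.eq_top_of_card_eq H (Nat.card_congr e.toEquiv)
  rintro ⟨H, hH⟩ ⟨K, hK⟩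
  exact Subtype.ext ((h H hH).trans (h K hK).symm)

theorem sub_pos_iff (A C : FinAbPGroup.{u} ℓ) :
    0 < sub A C ↔ ∃ f : A →+ C, Function.Injective f := by
  rw [sub, Nat.card_pos_iff]
  constructor
  · rintro ⟨⟨H, ⟨e⟩⟩, -⟩
    exact ⟨H.subtype.comp (e.symm : A →+ H), H.subtype_injective.comp e.symm.injective⟩
  · rintro ⟨f, hf⟩
    exact ⟨⟨f.range, ⟨(AddMonoidHom.ofInjective hf).symm⟩⟩, inferInstance⟩

/-- Any embedded copy of `B` in `B ⊕ (ℤ/ℓ)^k` spans it together with the `ℓ`-torsion. This property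
descends to the intermediate group `D`, so `D` splits over its copy of `B`. -/
theorem exists_equiv_addElementary_of_injective [Fact ℓ.Prime] {B D : FinAbPGroup.{u} ℓ} {k : ℕ}
    (f : B →+ D) (hf : Function.Injective f) (g : D →+ B.addElementary k)
    (hg : Function.Injective g) : ∃ j, B.addElementary j ≈ D := by
  have e := AddMonoidHom.ofInjective hf
  have h : (g.comp f).range ⊔ torsionKer ℓ (B.addElementary k) = ⊤ :=
    sup_torsionKer_eq_top_of_addEquiv
      (AddMonoidHom.ofInjective (f := g.comp f) (hg.comp hf)).symm
      (AddEquiv.refl (B × (Fin k → ZMod ℓ)))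
  have h' : f.range ⊔ torsionKer ℓ D = ⊤ := by
    rw [eq_top_iff]
    intro d _
    have hd : g d ∈ (g.comp f).range ⊔ torsionKer ℓ (B.addElementary k) := by rw [h]; trivial
    obtain ⟨_, ⟨b, rfl⟩, t, ht, hbt⟩ := AddSubgroup.mem_sup.1 hd
    refine AddSubgroup.mem_sup.2 ⟨f b, ⟨b, rfl⟩, d - f b, ?_, by abel⟩
    have ht' : g (d - f b) = t := by
      rw [map_sub, ← hbt]; simp
    rw [mem_torsionKer, ← map_eq_zero_iff g hg, map_nsmul, ht', mem_torsionKer.1 ht]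
  obtain ⟨j, ⟨e'⟩⟩ := exists_nonempty_addEquiv_prod_pi_of_sup_torsionKer_eq_top h'
  exact ⟨j, ⟨((e'.trans (e.symm.prodCongr (AddEquiv.refl _))).symm :
    B × (Fin j → ZMod ℓ) ≃+ D)⟩⟩

end FinAbPGroup

/-! ### Transfer to isomorphism classes -/

namespace FinAbPClass

variable {ℓ : ℕ}

section Classes

theorem sub_self (C : FinAbPClass.{u} ℓ) : sub C C = 1 := by
  induction C using Quotient.inductionOn with
  | _ C => exact FinAbPGroup.sub_self C

theorem sub_pos_iff {A C : FinAbPClass.{u} ℓ} : 0 < sub A C ↔ A ≤ C := by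
  induction A using Quotient.inductionOn with
  | _ A =>
  induction C using Quotient.inductionOn with
  | _ C => exact FinAbPGroup.sub_pos_iff A C

theorem sub_eq_zero_of_not_le {A C : FinAbPClass.{u} ℓ} (h : ¬ A ≤ C) : sub A C = 0 :=
  Nat.eq_zero_of_not_pos fun h' => h (sub_pos_iff.1 h')

variable [Fact ℓ.Prime]

theorem rank_mono {A B : FinAbPClass.{u} ℓ} (h : A ≤ B) : A.rank ≤ B.rank := by
  induction A using Quotient.inductionOn with
  | _ A =>
  induction B using Quotient.inductionOn with
  | _ B =>
  obtain ⟨f, hf⟩ := h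
  exact FinAbPGroup.rank_le_of_injective f hf

theorem rank_addElementary (B : FinAbPClass.{u} ℓ) (j : ℕ) :
    (B.addElementary j).rank = B.rank + j := by
  induction B using Quotient.inductionOn with
  | _ B => exact FinAbPGroup.rank_addElementary B j

theorem le_addElementary (B : FinAbPClass.{u} ℓ) (j : ℕ) : B ≤ B.addElementary j := by
  induction B using Quotient.inductionOn with
  | _ B =>
  exact ⟨AddMonoidHom.inl B (Fin j → ZMod ℓ), fun x y h => congrArg Prod.fst h⟩

theorem addElementary_zero (B : FinAbPClass.{u} ℓ) : B.addElementary 0 = B := by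
  induction B using Quotient.inductionOn with
  | _ B =>
  exact Quotient.sound ⟨(AddEquiv.prodUnique : B × (Fin 0 → ZMod ℓ) ≃+ B)⟩

theorem addElementary_injective (B : FinAbPClass.{u} ℓ) :
    Function.Injective B.addElementary := fun i j h => by
  have := congrArg rank h
  rw [rank_addElementary, rank_addElementary] at this
  omega

/-- Comparing ranks gives `j = j'`, and then the elementary summands cancel. This is the uniqueness
of `B` in the main theorem. -/
theorem eq_of_addElementary_eq {B B' : FinAbPClass.{u} ℓ} {j j' : ℕ} (hr : B.rank = B'.rank)
    (h : B.addElementary j = B'.addElementary j') : B = B' := by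
  obtain rfl : j = j' := by
    have := congrArg rank h
    rw [rank_addElementary, rank_addElementary] at this
    omega
  induction B using Quotient.inductionOn with
  | _ B =>
  induction B' using Quotient.inductionOn with
  | _ B' =>
  obtain ⟨e⟩ := Quotient.exact h
  exact Quotient.sound (nonempty_addEquiv_of_prod_pi_zmod (p := ℓ) j e)

theorem exists_eq_addElementary {B D : FinAbPClass.{u} ℓ} {k : ℕ} (h1 : B ≤ D)
    (h2 : D ≤ B.addElementary k) : ∃ j, B.addElementary j = D := by
  induction B using Quotient.inductionOn with
  | _ B =>
  induction D using Quotient.inductionOn with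
  | _ D =>
  obtain ⟨f, hf⟩ := h1
  obtain ⟨g, hg⟩ := h2
  obtain ⟨j, hj⟩ := FinAbPGroup.exists_equiv_addElementary_of_injective f hf g hg
  exact ⟨j, Quotient.sound hj⟩

theorem sub_mul_gaussCount (B C : FinAbPClass.{u} ℓ) (j : ℕ) :
    sub B C * gaussCount ℓ (C.rank - B.rank) j =
      sub (B.addElementary j) C * sub B (B.addElementary j) := by
  induction B using Quotient.inductionOn with
  | _ B =>
  induction C using Quotient.inductionOn with
  | _ C => exact FinAbPGroup.sub_mul_gaussCount B C j

end Classes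

/-! ### The recursion satisfied by `S` -/

section Recursion

/-- The strictly increasing lists `A < A₁ < ⋯ < A_i`, possibly empty after `A`, whose last entry
is `C`. -/
def chainsFromTo (A C : FinAbPClass.{u} ℓ) : Set (List (FinAbPClass.{u} ℓ)) :=
  {l | (A :: l).Pairwise (· < ·) ∧ l.getLastD A = C}

theorem le_of_mem_chainsFromTo {A C : FinAbPClass.{u} ℓ} {l : List (FinAbPClass.{u} ℓ)}
    (h : l ∈ chainsFromTo A C) : A ≤ C ∧ ∀ B ∈ A :: l, B ≤ C := by
  obtain ⟨h1, h2⟩ := h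
  rcases List.eq_nil_or_concat' l with rfl | ⟨l', D, rfl⟩
  · obtain rfl : A = C := h2
    simp
  · obtain rfl : D = C := by simpa using h2
    have h3 : ∀ B ∈ A :: (l' ++ [D]), B ≤ D := by
      intro B hB
      rw [← List.cons_append] at h1 hB
      rcases List.mem_append.1 hB with h | h
      · exact ((List.pairwise_append.1 h1).2.2 B h D (by simp)).le
      · exact (List.mem_singleton.1 h).le
    exact ⟨h3 A (by simp), h3⟩

theorem chainsFromTo_eq_chainsTo {A C : FinAbPClass.{u} ℓ} (h : A ≠ C) :
    chainsFromTo A C = chainsTo A C := by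
  ext l
  refine and_congr_right fun _ => ?_
  rcases List.eq_nil_or_concat' l with rfl | ⟨l', D, rfl⟩ <;> simp [h]

theorem chainsFromTo_self (A : FinAbPClass.{u} ℓ) : chainsFromTo A A = {[]} := by
  ext l
  constructor
  · intro h
    have h1 := (le_of_mem_chainsFromTo h).2
    rcases l with _ | ⟨B, l⟩
    · rfl
    · exact absurd (h1 B (by simp)) (not_le_of_gt ((List.pairwise_cons.1 h.1).1 B (by simp)))
  · rintro rfl
    exact ⟨by simp, rfl⟩

theorem finite_chainsFromTo (A C : FinAbPClass.{u} ℓ) : (chainsFromTo A C).Finite := by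
  rcases eq_or_ne A C with rfl | h
  · rw [chainsFromTo_self]; exact Set.finite_singleton _
  · rw [chainsFromTo_eq_chainsTo h]; exact finite_chainsTo A C

theorem S_eq_zero_of_not_le {A C : FinAbPClass.{u} ℓ} (h : ¬ A ≤ C) : S A C = 0 := by
  rw [S, if_pos h]

theorem S_self (A : FinAbPClass.{u} ℓ) : S A A = 1 := by
  rw [S, if_neg (not_not.2 le_rfl), if_pos rfl]

/-- Admitting the empty chain, which has weight 1 and ends at `A`, merges the three cases in the
definition of `S`. -/
theorem S_eq_sum (A C : FinAbPClass.{u} ℓ) :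
    S A C = ∑ l ∈ (finite_chainsFromTo A C).toFinset, chainSub A l := by
  by_cases h1 : A ≤ C
  · rcases eq_or_ne A C with rfl | h2
    · have : (finite_chainsFromTo A A).toFinset = {[]} := by
        ext l; simp [chainsFromTo_self]
      rw [this, Finset.sum_singleton, S_self]
      simp [chainSub]
    · rw [S, if_neg (not_not.2 h1), if_neg h2]
      refine Finset.sum_congr ?_ fun _ _ => rfl
      ext l
      simp [chainsFromTo_eq_chainsTo h2]
  · rw [S_eq_zero_of_not_le h1]
    refine (Finset.sum_eq_zero fun l hl => ?_).symm
    exact absurd (le_of_mem_chainsFromTo ((finite_chainsFromTo A C).mem_toFinset.1 hl)).1 h1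

theorem chainSub_cons (A B : FinAbPClass.{u} ℓ) (l : List (FinAbPClass.{u} ℓ)) :
    chainSub A (B :: l) = -(sub A B * chainSub B l) := by
  simp only [chainSub, List.length_cons, List.zipWith_cons_cons, List.prod_cons, pow_succ]
  ring

theorem chainSub_concat (A C : FinAbPClass.{u} ℓ) (l : List (FinAbPClass.{u} ℓ)) :
    chainSub A (l ++ [C]) = -(chainSub A l * sub (l.getLastD A) C) := by
  induction l generalizing A with
  | nil => simp [chainSub]
  | cons B l ih =>
    rw [List.cons_append, chainSub_cons, chainSub_cons, ih, List.getLastD_cons]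
    ring

/-- The Möbius-type recursion for `S`: the matrix `S` is a left inverse of the matrix `sub`. -/
theorem sum_S_mul_sub_eq_zero {A C : FinAbPClass.{u} ℓ} (h : A ≠ C) :
    ∑ D ∈ (finite_Iic C).toFinset, S A D * sub D C = 0 := by
  classical
  have hC : C ∈ (finite_Iic C).toFinset := by simp
  rw [← Finset.add_sum_erase _ _ hC, sub_self, Nat.cast_one, mul_one, S_eq_sum,
    add_eq_zero_iff_eq_neg, ← Finset.sum_neg_distrib]
  have h1 : ∀ D, -(S A D * sub D C) =
      ∑ l ∈ (finite_chainsFromTo A D).toFinset, chainSub A (l ++ [C]) := fun D => by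
    rw [S_eq_sum, Finset.sum_mul, ← Finset.sum_neg_distrib]
    refine Finset.sum_congr rfl fun l hl => ?_
    rw [chainSub_concat, ((finite_chainsFromTo A D).mem_toFinset.1 hl).2]
  rw [Finset.sum_congr rfl fun D _ => h1 D, Finset.sum_sigma']
  symm
  -- A chain from `A` to `C` is a chain from `A` to some `D < C` with `C` appended; the chain `[C]`
  -- comes from `D = A` and the empty list.
  refine Finset.sum_bij (fun x _ => x.2 ++ [C]) ?_ ?_ ?_ fun _ _ => rfl
  · rintro ⟨D, l⟩ hx
    simp only [Finset.mem_sigma, Finset.mem_erase, Set.Finite.mem_toFinset, Set.mem_Iic] at hx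
    obtain ⟨⟨h2, h3⟩, h4⟩ := hx
    rw [Set.Finite.mem_toFinset]
    refine ⟨?_, by simp⟩
    rw [← List.cons_append, List.pairwise_append]
    refine ⟨h4.1, by simp, fun B hB E hE => ?_⟩
    rw [List.mem_singleton.1 hE]
    exact lt_of_le_of_lt ((le_of_mem_chainsFromTo h4).2 B hB) (lt_of_le_of_ne h3 h2)
  · rintro ⟨D, l⟩ hx ⟨E, l'⟩ hy hxy
    obtain rfl : l = l' := List.append_cancel_right hxy
    simp only [Finset.mem_sigma, Set.Finite.mem_toFinset] at hx hy
    obtain rfl : D = E := hx.2.2.symm.trans hy.2.2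
    rfl
  · intro l hl
    rw [Set.Finite.mem_toFinset] at hl
    obtain ⟨h2, h3⟩ := hl
    rcases List.eq_nil_or_concat' l with rfl | ⟨l', E, rfl⟩
    · exact absurd h3 h
    · obtain rfl : E = C := by simpa using h3
      rw [← List.cons_append, List.pairwise_append] at h2
      have h4 : l'.getLastD A ∈ A :: l' := List.getLastD_mem_cons
      have h5 : l'.getLastD A < E := h2.2.2 _ h4 E (by simp)
      refine ⟨⟨l'.getLastD A, l'⟩, ?_, rfl⟩
      simp only [Finset.mem_sigma, Finset.mem_erase, Set.Finite.mem_toFinset, Set.mem_Iic]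
      exact ⟨⟨h5.ne, h5.le⟩, h2.1, rfl⟩

end Recursion

/-! ### Vanishing sums and the factorization of `S` -/

section Main

variable [Fact ℓ.Prime]

theorem sum_filter_addElementary {B C : FinAbPClass.{u} ℓ} (p : FinAbPClass.{u} ℓ → Prop)
    [DecidablePred p] (hp : ∀ D ∈ Set.Iic C, p D ↔ ∃ j, B.addElementary j = D)
    (w : FinAbPClass.{u} ℓ → ℤ) :
    ∑ D ∈ (finite_Iic C).toFinset with p D, w D * sub D C =
      ∑ j ∈ Finset.range (C.rank - B.rank + 1),
        w (B.addElementary j) * sub (B.addElementary j) C := by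
  classical
  rw [← Finset.sum_image (f := fun D => w D * (sub D C : ℤ)) (g := B.addElementary)
    (B.addElementary_injective.injOn)]
  refine Finset.sum_subset ?_ ?_
  · intro D hD
    simp only [Finset.mem_filter, Set.Finite.mem_toFinset] at hD
    obtain ⟨j, rfl⟩ := (hp D hD.1).1 hD.2
    have := rank_mono hD.1
    rw [rank_addElementary] at this
    exact Finset.mem_image_of_mem _ (Finset.mem_range.2 (by omega))
  · intro D hD hD'
    obtain ⟨j, -, rfl⟩ := Finset.mem_image.1 hD
    -- The indices `j` with `B ⊕ (ℤ/ℓ)^j ≰ C` are harmless, since their `sub` factor vanishes.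
    rw [sub_eq_zero_of_not_le, Nat.cast_zero, mul_zero]
    intro hle
    exact hD' (Finset.mem_filter.2 ⟨(finite_Iic C).mem_toFinset.2 hle, (hp _ hle).2 ⟨j, rfl⟩⟩)

/-- This is the recursion for `S` from `B` to `B ⊕ (ℤ/ℓ)^m`: only classes above `B` contribute, and
those in the interval are all of the form `B ⊕ (ℤ/ℓ)^j`. -/
theorem sum_S_addElementary_self (B : FinAbPClass.{u} ℓ) {m : ℕ} (hm : 0 < m) :
    ∑ j ∈ Finset.range (m + 1),
      S B (B.addElementary j) * sub (B.addElementary j) (B.addElementary m) = 0 := by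
  classical
  have h0 : B ≠ B.addElementary m := fun h => by
    have := congrArg rank h
    rw [rank_addElementary] at this
    omega
  have h1 := sum_filter_addElementary (B := B) (C := B.addElementary m)
    (fun D => B ≤ D) (fun D hD => ⟨fun h => exists_eq_addElementary h hD, fun ⟨j, hj⟩ =>
      hj ▸ le_addElementary B j⟩) (S B)
  rw [rank_addElementary, Nat.add_sub_cancel_left] at h1
  rw [← h1, ← sum_S_mul_sub_eq_zero h0, Finset.sum_filter_of_ne]
  intro D _ hD
  by_contra hBD
  exact hD (by rw [S_eq_zero_of_not_le hBD, zero_mul])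

theorem sum_S_addElementary {B C : FinAbPClass.{u} ℓ} (h : B.rank < C.rank) :
    ∑ j ∈ Finset.range (C.rank - B.rank + 1),
      S B (B.addElementary j) * sub (B.addElementary j) C = 0 := by
  set m := C.rank - B.rank with hm
  -- Over `ℚ` one may divide by `sub B (B.addElementary j)`; the remaining sum depends on `E` only
  -- through `m`, so its vanishing can be tested on `B.addElementary m`.
  have key : ∀ E : FinAbPClass.{u} ℓ, E.rank - B.rank = m →
      (∑ j ∈ Finset.range (m + 1),
        S B (B.addElementary j) * sub (B.addElementary j) E : ℚ) =
      sub B E * ∑ j ∈ Finset.range (m + 1),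
        (S B (B.addElementary j) : ℚ) * gaussCount ℓ m j / sub B (B.addElementary j) := by
    intro E hE
    rw [Finset.mul_sum]
    refine Finset.sum_congr rfl fun j _ => ?_
    have h1 : (sub B E * gaussCount ℓ m j : ℚ) =
        sub (B.addElementary j) E * sub B (B.addElementary j) := by
      exact_mod_cast hE ▸ sub_mul_gaussCount B E j
    have h2 : (sub B (B.addElementary j) : ℚ) ≠ 0 :=
      Nat.cast_ne_zero.2 (sub_pos_iff.2 (le_addElementary B j)).ne'
    field_simp
    linear_combination -(S B (B.addElementary j) : ℚ) * h1
  have h1 := key (B.addElementary m) (by rw [rank_addElementary]; omega)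
  have h2 : (∑ j ∈ Finset.range (m + 1), S B (B.addElementary j) *
      sub (B.addElementary j) (B.addElementary m) : ℚ) = 0 := by
    exact_mod_cast sum_S_addElementary_self B (m := m) (by omega)
  rw [h2] at h1
  have h3 := (mul_eq_zero.1 h1.symm).resolve_left
    (Nat.cast_ne_zero.2 (sub_pos_iff.2 (le_addElementary B m)).ne')
  have h4 := key C hm.symm
  rw [h3, mul_zero] at h4
  exact_mod_cast h4

-- Induction on the number of classes below `C`. When `rank C > rank A`, both sides satisfy the same
-- recursion and agree strictly below `C`, hence agree at `C`. The set `N` need not lie above `A`,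
-- because `S A B` vanishes for other `B`; keeping `N` fixed lets the induction hypothesis and the
-- interchange of sums use the same index set.
open Classical in
theorem S_eq_sum_addElementary {A : FinAbPClass.{u} ℓ} (N : Finset (FinAbPClass.{u} ℓ))
    (hr : ∀ B ∈ N, B.rank = A.rank) (C : FinAbPClass.{u} ℓ)
    (hN : ∀ D, D ≤ C → D.rank = A.rank → D ∈ N) :
    S A C = ∑ B ∈ N, if ∃ j, B.addElementary j = C then S A B * S B C else 0 := by
  induction hn : (Set.Iic C).ncard using Nat.strong_induction_on generalizing C with
  | _ n ih =>
  subst hn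
  have hlt : ∀ D, D < C →
      S A D = ∑ B ∈ N, if ∃ j, B.addElementary j = D then S A B * S B D else 0 := fun D hD =>
    ih _ (Set.ncard_lt_ncard (Set.Iic_ssubset_Iic.2 hD) (finite_Iic C)) D
      (fun E hE => hN E (hE.trans hD.le)) rfl
  rcases lt_trichotomy C.rank A.rank with h | h | h
  · rw [S_eq_zero_of_not_le fun h' => (rank_mono h').not_gt h]
    refine (Finset.sum_eq_zero fun B hB => if_neg ?_).symm
    rintro ⟨j, rfl⟩
    rw [rank_addElementary, hr B hB] at h
    omega
  · rw [Finset.sum_eq_single_of_mem C (hN C le_rfl h),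
      if_pos ⟨0, addElementary_zero C⟩, S_self, mul_one]
    intro B hB hBC
    refine if_neg fun ⟨j, hj⟩ => hBC ?_
    exact eq_of_addElementary_eq ((hr B hB).trans h.symm) (hj.trans (addElementary_zero C).symm)
  · have hAC : A ≠ C := fun h' => by rw [h'] at h; exact lt_irrefl _ h
    have hC : C ∈ (finite_Iic C).toFinset := by simp
    have h1 := sum_S_mul_sub_eq_zero hAC
    have h2 : ∑ D ∈ (finite_Iic C).toFinset,
        (∑ B ∈ N, if ∃ j, B.addElementary j = D then S A B * S B D else 0) * (sub D C : ℤ) = 0 := by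
      simp_rw [Finset.sum_mul]
      rw [Finset.sum_comm]
      refine Finset.sum_eq_zero fun B hB => ?_
      have h3 := sum_filter_addElementary (B := B) (C := C)
        (fun D => ∃ j, B.addElementary j = D) (fun _ _ => Iff.rfl) (S B)
      rw [sum_S_addElementary ((hr B hB).trans_lt h), Finset.sum_filter] at h3
      refine Eq.trans ?_ (mul_eq_zero_of_right (S A B) h3)
      rw [Finset.mul_sum]
      refine Finset.sum_congr rfl fun D _ => ?_
      split_ifs <;> ring
    rw [← Finset.add_sum_erase _ _ hC, sub_self, Nat.cast_one, mul_one] at h1 h2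
    -- The terms with `D < C` coincide by induction, which leaves equality of the two `D = C` terms.
    rw [← h2, Finset.sum_congr rfl fun D hD => ?_] at h1
    · exact add_right_cancel h1
    · rw [hlt D]
      rw [Finset.mem_erase, Set.Finite.mem_toFinset] at hD
      exact lt_of_le_of_ne hD.2 hD.1

end Main

end FinAbPClass

theorem mainTheorem1 (ℓ : ℕ) [Fact ℓ.Prime] (hodd : Odd ℓ) (A C : FinAbPClass.{u} ℓ)
    (hrank : A.rank < C.rank) :
    (∀ (k : ℕ) (B : FinAbPClass.{u} ℓ), 0 < k → A ≤ B → B < C → B.rank = A.rank →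
        B.addElementary k = C → A.S C = A.S B * B.S C) ∧
    ((¬ ∃ (k : ℕ) (B : FinAbPClass.{u} ℓ), 0 < k ∧ A ≤ B ∧ B < C ∧ B.rank = A.rank ∧
        B.addElementary k = C) → A.S C = 0) := by
  classical
  have hS := FinAbPClass.S_eq_sum_addElementary (A := A)
    {B ∈ (FinAbPClass.finite_Iic C).toFinset | B.rank = A.rank}
    (fun B hB => (Finset.mem_filter.1 hB).2) C
    (fun D h1 h2 => Finset.mem_filter.2 ⟨(FinAbPClass.finite_Iic C).mem_toFinset.2 h1, h2⟩)
  constructor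
  · intro k B _ _ hBC hBr hk
    rw [hS, Finset.sum_eq_single_of_mem B, if_pos ⟨k, hk⟩]
    · exact Finset.mem_filter.2 ⟨(FinAbPClass.finite_Iic C).mem_toFinset.2 hBC.le, hBr⟩
    · intro B' hB' hne
      refine if_neg fun ⟨j, hj⟩ => hne ?_
      exact FinAbPClass.eq_of_addElementary_eq ((Finset.mem_filter.1 hB').2.trans hBr.symm)
        (hj.trans hk.symm)
  · intro hno
    rw [hS]
    refine Finset.sum_eq_zero fun B hB => ?_
    have hBr := (Finset.mem_filter.1 hB).2
    split_ifs with h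
    · obtain ⟨j, rfl⟩ := h
      by_cases hAB : A ≤ B
      · refine absurd ⟨j, B, ?_, hAB, lt_of_le_of_ne (B.le_addElementary j) ?_, hBr, rfl⟩ hno
        -- The strict inequality of ranks excludes `j = 0`.
        · rw [FinAbPClass.rank_addElementary] at hrank
          omega
        · intro h
          rw [← h, hBr] at hrank
          exact lt_irrefl _ hrank
      · rw [FinAbPClass.S_eq_zero_of_not_le hAB, zero_mul]
    · rfl
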